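/- **Corollary 5.3 (Gaussian limit of COE entries).** An $N\times N$ COE (circular orthogonal ensemble) matrix is a random symmetric unitary $N\times N$ matrix $V$ whose law is invariant under $V\mapsto U_0^{\mathsf T} V U_0$ for every fixed unitary $N\times N$ matrix $U_0$ (equivalently, $V$ has the law of $U^{\mathsf T}U$ with $U$ Haar-distributed on the unitary group $U(N)$). A standard complex Gaussian random variable is $Z=(X_1+\sqrt{-1}\,X_2)/\sqrt2$, where $X_1,X_2$ are independent standard real Gaussian random variables. Let $V^{(N)}=(v^{(N)}_{ij})_{1\le i,j\le N}$, $N\ge 1$, be a sequence of COE matrices, where $V^{(N)}$ is $N\times N$ (the matrices may be defined on different probability spaces). Fix positive integers $i\ne j$. Then, as $N\to\infty$ (with $N \geq \max(i,j)$), each of the random variables $\sqrt{N/2}\,v^{(N)}_{ii}$ and $\sqrt{N}\,v^{(N)}_{ij}$ converges weakly (in distribution) to a standard complex Gaussian random variable. -/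

import Mathlib

open MeasureTheory ProbabilityTheory Filter

noncomputable section

/-- The product (= Borel) sigma-algebra on matrices, generated by the entries. -/
instance matrixMeasurableSpace {m n α : Type*} [MeasurableSpace α] :
    MeasurableSpace (Matrix m n α) :=
  inferInstanceAs (MeasurableSpace (m → n → α))

/-- `V` is a COE (circular orthogonal ensemble) random matrix under the probability measure `P`:
a random symmetric unitary matrix whose law is invariant under all the maps
`V ↦ Uᵀ * V * U`, where `U` is a fixed unitary matrix. -/
structure IsCOE {Ω n : Type*} [MeasurableSpace Ω] [Fintype n] [DecidableEq n]
    (V : Ω → Matrix n n ℂ) (P : Measure Ω) : Prop where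
  isProbabilityMeasure : IsProbabilityMeasure P
  aemeasurable : AEMeasurable V P
  unitary : ∀ᵐ ω ∂P, V ω ∈ Matrix.unitaryGroup n ℂ
  symmetric : ∀ᵐ ω ∂P, (V ω).IsSymm
  invariant : ∀ U ∈ Matrix.unitaryGroup n ℂ,
    P.map (fun ω => U.transpose * V ω * U) = P.map V

/-- `Z` is a standard complex Gaussian random variable under `P`: `Z = (X₁ + √-1 X₂) / √2` with
`X₁`, `X₂` independent standard real Gaussian random variables. -/
def IsStandardComplexGaussian {Ω : Type*} [MeasurableSpace Ω] (Z : Ω → ℂ) (P : Measure Ω) : Prop :=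
  ∃ X₁ X₂ : Ω → ℝ, HasLaw X₁ (gaussianReal 0 1) P ∧ HasLaw X₂ (gaussianReal 0 1) P ∧
    IndepFun X₁ X₂ P ∧
    ∀ ω, Z ω = ((X₁ ω : ℂ) + Complex.I * (X₂ ω : ℂ)) / ((√2 : ℝ) : ℂ)

/-- The `(i, j)` entry of an `N × N` matrix, for positive integers `i, j` (rows and columns are
labelled `1, …, N`, so label `i` is the element `i - 1` of `Fin N`). The value is `0` when `i` or
`j` is not one of the labels `1, …, N`. -/
def matrixEntry {N : ℕ} (A : Matrix (Fin N) (Fin N) ℂ) (i j : ℕ) : ℂ :=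
  if h : (1 ≤ i ∧ i ≤ N) ∧ (1 ≤ j ∧ j ≤ N) then
    A ⟨i - 1, by omega⟩ ⟨j - 1, by omega⟩
  else 0

end

/-!
An integration by parts (Schwinger–Dyson) identity on the COE gives an approximate differential
equation for the characteristic function of a single entry, and Lévy's continuity theorem finishes.

For skew-Hermitian `A` the expectation `E F(exp(tA)ᵀ V exp(tA))` does not depend on `t`, so the
expected derivative of `F` at `V` in the direction `Aᵀ V + V A` vanishes. With `conj A = -Aᵀ`
the derivative is written as a complex-linear function of `A`, so the identity holds for every
complex matrix `A`. Applying it to `F = conj(v_pa) g(v_pq)` and `A = E_{aq}`, and summing over `a`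
with the help of unitarity and symmetry, yields, for `v = v_pq`,
`(N + 1) E[v̄ g(v)] = (1 + δ_pq) E[∂g(v)] - E[∂̄g(v) (v̄_pp v̄_qq + v̄²)]`
(`IsCOE.schwinger_dyson`).

For `g(v) = v` this says `E|v_pq|² = (1 + δ_pq) / (N + 1)`, so that the last factor above is
`O(1 / N)` in mean. For `g(v) = exp(i Re(b̄ v))` it says that `φ(s) = E exp(i s Re(b̄ v))` satisfies
`φ'(s) = -2κ s φ(s) + O(|b|² s / N²)` with `κ = (1 + δ_pq) |b|² / (4 (N + 1))`
(`IsCOE.hasDerivAt_integral_expReInner`). Integrating from `0` to `1` bounds the distance of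
`φ(1)` from `exp(-κ)` by `2 |b|² / (N + 1)²` (`IsCOE.norm_integral_expReInner_sub_le`).
At `b = √(N / (1 + δ_pq)) w` this converges to `exp(-|w|² / 4)`, the characteristic function of the
standard complex Gaussian.
-/

open scoped ComplexConjugate Topology

/-! ### Orbits `exp(tA)ᵀ M exp(tA)` of one-parameter unitary groups -/

section UnitaryOrbits

variable {n : Type*} [Fintype n]

instance : BorelSpace (Matrix n n ℂ) :=
  inferInstanceAs (BorelSpace (n → n → ℂ))

/-- Differentiability is stated entrywise, so that no norm on matrices has to be chosen. -/
lemma hasDerivAt_mul_apply {M N : ℝ → Matrix n n ℂ} {M' N' : Matrix n n ℂ} {t : ℝ}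
    (hM : ∀ k l, HasDerivAt (fun s => M s k l) (M' k l) t)
    (hN : ∀ k l, HasDerivAt (fun s => N s k l) (N' k l) t) (k l : n) :
    HasDerivAt (fun s => (M s * N s) k l) ((M' * N t + M t * N') k l) t := by
  simp only [Matrix.mul_apply, Matrix.add_apply, ← Finset.sum_add_distrib]
  exact HasDerivAt.fun_sum fun m _ => (hM k m).mul (hN m l)

variable [DecidableEq n]

/-- Unitary matrices lie in the compact set of matrices with entries in the unit disc. -/
lemma exists_norm_le_of_mem_unitaryGroup {F : Matrix n n ℂ → ℂ} (hF : Continuous F) :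
    ∃ C, ∀ M ∈ Matrix.unitaryGroup n ℂ, ‖F M‖ ≤ C := by
  have hK : IsCompact (Set.univ.pi fun _ : n => Set.univ.pi fun _ : n =>
      Metric.closedBall (0 : ℂ) 1) :=
    isCompact_univ_pi fun _ => isCompact_univ_pi fun _ => isCompact_closedBall _ _
  obtain ⟨C, hC⟩ := hK.exists_bound_of_continuousOn (f := F) hF.continuousOn
  refine ⟨C, fun M hM => hC M ?_⟩
  intro k _ l _
  simpa using entry_norm_bound_of_unitary hM k l

open scoped Matrix.Norms.L2Operator in
lemma hasDerivAt_exp_smul_apply (A : Matrix n n ℂ) (t : ℝ) (k l : n) :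
    HasDerivAt (fun s : ℝ => NormedSpace.exp (s • A) k l)
      ((NormedSpace.exp (t • A) * A) k l) t := by
  have h := hasDerivAt_exp_smul_const (𝕂 := ℝ) A t
  let ev : Matrix n n ℂ →ₗ[ℝ] ℂ :=
    { toFun := fun M => M k l, map_add' := fun _ _ => rfl, map_smul' := fun _ _ => rfl }
  exact (ev.toContinuousLinearMap.hasFDerivAt (x := NormedSpace.exp (t • A))).comp_hasDerivAt t h

open scoped Matrix.Norms.L2Operator in
lemma exp_smul_mem_unitaryGroup {A : Matrix n n ℂ} (hA : A.conjTranspose = -A) (t : ℝ) :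
    NormedSpace.exp (t • A) ∈ Matrix.unitaryGroup n ℂ := by
  let +nondep : NormedAlgebra ℚ (Matrix n n ℂ) := .restrictScalars ℚ ℝ _
  refine NormedSpace.exp_mem_unitary_of_mem_skewAdjoint ?_
  rw [skewAdjoint.mem_iff, Matrix.star_eq_conjTranspose, Matrix.conjTranspose_smul, hA]
  simp

/-- The orbit `M_t = exp(tA)ᵀ M exp(tA)` solves `M_t' = Aᵀ M_t + M_t A`. -/
lemma hasDerivAt_transpose_exp_mul_mul_exp_apply (A M : Matrix n n ℂ) (t : ℝ) (k l : n) :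
    HasDerivAt (fun s : ℝ => ((NormedSpace.exp (s • A)).transpose * M *
        NormedSpace.exp (s • A)) k l)
      ((A.transpose * ((NormedSpace.exp (t • A)).transpose * M * NormedSpace.exp (t • A)) +
        ((NormedSpace.exp (t • A)).transpose * M * NormedSpace.exp (t • A)) * A) k l) t := by
  have h := hasDerivAt_mul_apply (t := t)
    (hasDerivAt_mul_apply (t := t) (M := fun s : ℝ => (NormedSpace.exp (s • A)).transpose)
      (M' := (NormedSpace.exp (t • A) * A).transpose)
      (N := fun _ => M) (N' := 0) (fun k l => hasDerivAt_exp_smul_apply A t l k)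
      (fun k l => by simpa using hasDerivAt_const t (M k l)))
    (hasDerivAt_exp_smul_apply A t) k l
  simpa only [Matrix.mul_zero, add_zero, Matrix.transpose_mul, Matrix.mul_assoc] using h

end UnitaryOrbits

/-! ### Integration by parts on the circular orthogonal ensemble -/

section SchwingerDyson

section WirtingerVariation

variable {n : Type*} [Fintype n]

/-- The derivative of `M ↦ conj (M p a) * g (M p q)` in the direction `Aᵀ * M + M * A`, rewritten
with `conj A = -Aᵀ` so that it is complex linear in `A`. Here `G₁` and `G₂` stand for the
Wirtinger derivatives `∂g` and `∂̄g`. -/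
def wirtingerVariation (g G₁ G₂ : ℂ → ℂ) (p a q : n) (M A : Matrix n n ℂ) : ℂ :=
  -(A * M.map conj + M.map conj * A.transpose) p a * g (M p q) +
    conj (M p a) * (G₁ (M p q) * (A.transpose * M + M * A) p q -
      G₂ (M p q) * (A * M.map conj + M.map conj * A.transpose) p q)

variable {g G₁ G₂ : ℂ → ℂ}

lemma continuous_wirtingerVariation (hg : Continuous g) (h₁ : Continuous G₁) (h₂ : Continuous G₂)
    (p a q : n) (A : Matrix n n ℂ) :
    Continuous fun M => wirtingerVariation g G₁ G₂ p a q M A := by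
  have hconj : Continuous fun M : Matrix n n ℂ => M.map conj :=
    continuous_id.matrix_map Complex.continuous_conj
  have e (B : Matrix n n ℂ → Matrix n n ℂ) (hB : Continuous B) (k l : n) :
    Continuous fun M => B M k l := hB.matrix_elem k l
  have hE := e _ continuous_id
  have hX := e (fun M => A * M.map conj + M.map conj * A.transpose) (by fun_prop)
  have hY := e (fun M => A.transpose * M + M * A) (by fun_prop)
  unfold wirtingerVariation
  exact ((hX p a).neg.mul (hg.comp (hE p q))).add ((Complex.continuous_conj.comp (hE p a)).mul
    (((h₁.comp (hE p q)).mul (hY p q)).sub ((h₂.comp (hE p q)).mul (hX p q))))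

lemma wirtingerVariation_add_smul (p a q : n) (M S T : Matrix n n ℂ) (c : ℂ) :
    wirtingerVariation g G₁ G₂ p a q M (S + c • T) =
      wirtingerVariation g G₁ G₂ p a q M S + c * wirtingerVariation g G₁ G₂ p a q M T := by
  simp only [wirtingerVariation, Matrix.transpose_add, Matrix.transpose_smul, Matrix.add_mul,
    Matrix.mul_add, Matrix.smul_mul, Matrix.mul_smul, Matrix.add_apply, Matrix.smul_apply,
    smul_eq_mul]
  ring

end WirtingerVariation

variable {Ω n : Type*} [MeasurableSpace Ω] [Fintype n] [DecidableEq n]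
  {V : Ω → Matrix n n ℂ} {P : Measure Ω}

lemma IsCOE.integrable_comp (hV : IsCOE V P) {F : Matrix n n ℂ → ℂ} (hF : Continuous F) :
    Integrable (fun ω => F (V ω)) P := by
  have := hV.isProbabilityMeasure
  obtain ⟨C, hC⟩ := exists_norm_le_of_mem_unitaryGroup hF
  exact Integrable.of_bound (hF.measurable.comp_aemeasurable hV.aemeasurable).aestronglyMeasurable C
    (hV.unitary.mono fun ω hω => hC _ hω)

lemma transpose_mul_mul_mem_unitaryGroup {U M : Matrix n n ℂ}
    (hU : U ∈ Matrix.unitaryGroup n ℂ) (hM : M ∈ Matrix.unitaryGroup n ℂ) :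
    U.transpose * M * U ∈ Matrix.unitaryGroup n ℂ :=
  mul_mem (mul_mem (Matrix.transpose_mem_unitaryGroup_iff.2 hU) hM) hU

lemma IsCOE.integral_comp_transpose_mul_mul (hV : IsCOE V P) {F : Matrix n n ℂ → ℂ} (hF : Continuous F)
    {U : Matrix n n ℂ} (hU : U ∈ Matrix.unitaryGroup n ℂ) :
    ∫ ω, F (U.transpose * V ω * U) ∂P = ∫ ω, F (V ω) ∂P := by
  have hc : Continuous fun M : Matrix n n ℂ => U.transpose * M * U := by fun_prop
  have hm : AEMeasurable (fun ω => U.transpose * V ω * U) P :=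
    hc.measurable.comp_aemeasurable hV.aemeasurable
  rw [← integral_map hV.aemeasurable hF.aestronglyMeasurable, ← hV.invariant U hU,
    integral_map hm hF.aestronglyMeasurable]

/-- Infinitesimal invariance of the COE: `t ↦ E F(exp(tA)ᵀ V exp(tA))` is constant for
skew-Hermitian `A`, and its derivative at `0` can be taken under the expectation. `DF` is the
derivative of `F`, specified by the chain rule along entrywise differentiable curves. -/
lemma IsCOE.integral_deriv_eq_zero (hV : IsCOE V P) {F : Matrix n n ℂ → ℂ} (hF : Continuous F)
    {DF : Matrix n n ℂ → Matrix n n ℂ → ℂ}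
    (hDF : ∀ (γ : ℝ → Matrix n n ℂ) (γ' : Matrix n n ℂ) (t : ℝ),
      (∀ k l, HasDerivAt (fun s => γ s k l) (γ' k l) t) →
        HasDerivAt (fun s => F (γ s)) (DF (γ t) γ') t)
    {A : Matrix n n ℂ} (hA : A.conjTranspose = -A)
    (hc : Continuous fun M => DF M (A.transpose * M + M * A)) :
    ∫ ω, DF (V ω) (A.transpose * V ω + V ω * A) ∂P = 0 := by
  have := hV.isProbabilityMeasure
  obtain ⟨C, hC⟩ := exists_norm_le_of_mem_unitaryGroup hc
  have hconj (t : ℝ) : Continuous fun M : Matrix n n ℂ =>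
      (NormedSpace.exp (t • A)).transpose * M * NormedSpace.exp (t • A) := by fun_prop
  have key := (hasDerivAt_integral_of_dominated_loc_of_deriv_le (μ := P) (x₀ := (0 : ℝ))
    (s := Set.univ) (bound := fun _ => C)
    (F := fun t ω => F ((NormedSpace.exp (t • A)).transpose * V ω * NormedSpace.exp (t • A)))
    (F' := fun t ω => DF ((NormedSpace.exp (t • A)).transpose * V ω * NormedSpace.exp (t • A))
      (A.transpose * ((NormedSpace.exp (t • A)).transpose * V ω * NormedSpace.exp (t • A)) +
        ((NormedSpace.exp (t • A)).transpose * V ω * NormedSpace.exp (t • A)) * A))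
    univ_mem
    (Eventually.of_forall fun t =>
      (hV.integrable_comp (hF.comp (hconj t))).aestronglyMeasurable)
    (hV.integrable_comp (hF.comp (hconj 0)))
    (hV.integrable_comp (hc.comp (hconj 0))).aestronglyMeasurable
    (hV.unitary.mono fun ω hω t _ =>
      hC _ (transpose_mul_mul_mem_unitaryGroup (exp_smul_mem_unitaryGroup hA t) hω))
    (integrable_const C)
    (Eventually.of_forall fun ω t _ =>
      hDF _ _ t fun k l => hasDerivAt_transpose_exp_mul_mul_exp_apply A (V ω) t k l)).2
  have hconst : (fun t : ℝ => ∫ ω, F ((NormedSpace.exp (t • A)).transpose * V ω *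
      NormedSpace.exp (t • A)) ∂P) = fun _ => ∫ ω, F (V ω) ∂P :=
    funext fun t => hV.integral_comp_transpose_mul_mul hF (exp_smul_mem_unitaryGroup hA t)
  rw [hconst] at key
  simpa using key.unique (hasDerivAt_const _ _)

variable {g G₁ G₂ : ℂ → ℂ}

lemma IsCOE.integral_wirtingerVariation_of_skew (hV : IsCOE V P)
    (hg : ∀ z, HasFDerivAt (𝕜 := ℝ) g
      (G₁ z • (ContinuousLinearMap.id ℝ ℂ) + G₂ z • (Complex.conjCLE : ℂ →L[ℝ] ℂ)) z)
    (h₁ : Continuous G₁) (h₂ : Continuous G₂) (p a q : n) {A : Matrix n n ℂ}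
    (hA : A.conjTranspose = -A) :
    ∫ ω, wirtingerVariation g G₁ G₂ p a q (V ω) A ∂P = 0 := by
  have hgc : Continuous g := continuous_iff_continuousAt.2 fun z => (hg z).continuousAt
  have hconjA : A.map conj = -A.transpose := by
    ext k l
    simpa using congrFun (congrFun hA l) k
  have hX (M : Matrix n n ℂ) (k l : n) : conj ((A.transpose * M + M * A) k l) =
      -(A * M.map conj + M.map conj * A.transpose) k l := by
    have h : (A.transpose * M + M * A).map conj =
        -(A * M.map conj + M.map conj * A.transpose) := by
      rw [Matrix.map_add _ (map_add _), Matrix.map_mul, Matrix.map_mul, hconjA,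
        Matrix.transpose_map, hconjA]
      simp [add_comm]
    exact congrFun (congrFun h k) l
  have hE (M : Matrix n n ℂ) : wirtingerVariation g G₁ G₂ p a q M A =
      conj ((A.transpose * M + M * A) p a) * g (M p q) + conj (M p a) *
        (G₁ (M p q) * (A.transpose * M + M * A) p q +
          G₂ (M p q) * conj ((A.transpose * M + M * A) p q)) := by
    rw [hX, hX, wirtingerVariation]
    ring
  simp_rw [hE]
  refine hV.integral_deriv_eq_zero (F := fun M => conj (M p a) * g (M p q))
    (DF := fun M X => conj (X p a) * g (M p q) + conj (M p a) *
        (G₁ (M p q) * X p q + G₂ (M p q) * conj (X p q)))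
    (by fun_prop) ?_ hA ?_
  · intro γ γ' t hγ
    have h1 : HasDerivAt (fun s => conj (γ s p a)) (conj (γ' p a)) t :=
      (Complex.conjCLE : ℂ →L[ℝ] ℂ).hasFDerivAt.comp_hasDerivAt t (hγ p a)
    have h2 := (hg (γ t p q)).comp_hasDerivAt t (hγ p q)
    exact (h1.fun_mul h2).congr_deriv (by simp)
  · simp_rw [← hE]
    exact continuous_wirtingerVariation hgc h₁ h₂ p a q A

/-- Infinitesimal invariance extends from skew-Hermitian to all `A` by complex linearity. -/
lemma IsCOE.integral_wirtingerVariation (hV : IsCOE V P)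
    (hg : ∀ z, HasFDerivAt (𝕜 := ℝ) g
      (G₁ z • (ContinuousLinearMap.id ℝ ℂ) + G₂ z • (Complex.conjCLE : ℂ →L[ℝ] ℂ)) z)
    (h₁ : Continuous G₁) (h₂ : Continuous G₂) (p a q : n) (A : Matrix n n ℂ) :
    ∫ ω, wirtingerVariation g G₁ G₂ p a q (V ω) A ∂P = 0 := by
  have hgc : Continuous g := continuous_iff_continuousAt.2 fun z => (hg z).continuousAt
  -- `A = S + i T` with `S` and `T` skew-Hermitian.
  set S := (1 / 2 : ℂ) • (A - A.conjTranspose) with hS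
  set T := (-Complex.I / 2) • (A + A.conjTranspose) with hT
  have hSs : S.conjTranspose = -S := by
    rw [hS, Matrix.conjTranspose_smul, Matrix.conjTranspose_sub, Matrix.conjTranspose_conjTranspose,
      ← smul_neg, neg_sub]
    simp
  have hTs : T.conjTranspose = -T := by
    rw [hT, Matrix.conjTranspose_smul, Matrix.conjTranspose_add, Matrix.conjTranspose_conjTranspose,
      ← neg_smul, add_comm]
    congr 1
    simp [neg_div]
  have hAd : A = S + Complex.I • T := by
    ext k l
    simp only [hS, hT, Matrix.add_apply, Matrix.smul_apply, Matrix.sub_apply, smul_eq_mul]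
    linear_combination ((A k l + A.conjTranspose k l) / 2) * Complex.I_mul_I
  have hi (B : Matrix n n ℂ) :=
    hV.integrable_comp (continuous_wirtingerVariation hgc h₁ h₂ p a q B)
  rw [hAd]
  simp_rw [wirtingerVariation_add_smul]
  rw [integral_add (hi S) ((hi T).const_mul _), integral_const_mul,
    hV.integral_wirtingerVariation_of_skew hg h₁ h₂ p a q hSs,
    hV.integral_wirtingerVariation_of_skew hg h₁ h₂ p a q hTs]
  simp

/-- The sum over `a` of the variations along `A = E_{aq}`; unitarity collapses the `∂g` term, since
row `p` of `M` has norm one and, for `p = q`, symmetry turns column `q` into row `p`. -/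
lemma sum_wirtingerVariation_single {M : Matrix n n ℂ} (hM : M ∈ Matrix.unitaryGroup n ℂ)
    (hs : M.IsSymm) (p q : n) :
    ∑ a, wirtingerVariation g G₁ G₂ p a q M (Matrix.single a q 1) =
      (if p = q then 2 else 1) * G₁ (M p q) -
        G₂ (M p q) * (conj (M p p) * conj (M q q) + conj (M p q) ^ 2) -
        (Fintype.card n + 1) * (conj (M p q) * g (M p q)) := by
  have hrow : ∑ a, conj (M p a) * M p a = 1 := by
    have h := congrFun (congrFun (Matrix.mem_unitaryGroup_iff.1 hM) p) p
    simpa [Matrix.mul_apply, Matrix.star_apply, mul_comm] using h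
  have hsy (k l : n) : M k l = M l k := hs.apply l k
  have hterm (a : n) : wirtingerVariation g G₁ G₂ p a q M (Matrix.single a q 1) =
      (if p = q then 2 else 1) * G₁ (M p q) * (conj (M p a) * M p a) -
        G₂ (M p q) * ((if p = a then conj (M p p) * conj (M q q) else 0) +
          (if a = q then conj (M p q) ^ 2 else 0)) -
        ((if p = a then conj (M p q) * g (M p q) else 0) + conj (M p q) * g (M p q)) := by
    have e1 : (Matrix.single a q (1 : ℂ) * M.map conj) p a =
        if p = a then conj (M q a) else 0 := by
      split_ifs with h
      · subst h; simp
      · simp [h]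
    have e2 : (M.map conj * Matrix.single q a (1 : ℂ)) p a = conj (M p q) := by simp
    have e3 : (Matrix.single q a (1 : ℂ) * M) p q = if p = q then M a q else 0 := by
      split_ifs with h
      · subst h; simp
      · simp [h]
    have e4 : (M * Matrix.single a q (1 : ℂ)) p q = M p a := by simp
    have e5 : (Matrix.single a q (1 : ℂ) * M.map conj) p q =
        if p = a then conj (M q q) else 0 := by
      split_ifs with h
      · subst h; simp
      · simp [h]
    have e6 : (M.map conj * Matrix.single q a (1 : ℂ)) p q =
        if a = q then conj (M p q) else 0 := by
      split_ifs with h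
      · subst h; simp
      · simp [Ne.symm h]
    simp only [wirtingerVariation, Matrix.transpose_single, Matrix.add_apply, e1, e2, e3, e4, e5, e6]
    by_cases hpq : p = q
    · subst hpq
      rw [hsy a p]
      by_cases hpa : p = a
      · subst hpa; simp; ring
      · simp [hpa, Ne.symm hpa]; ring
    · by_cases hpa : p = a
      · subst hpa; rw [hsy q p]; simp [hpq]; ring
      · by_cases haq : a = q
        · subst haq; simp [hpa]; ring
        · simp [hpa, haq, hpq]
          ring
  simp_rw [hterm, Finset.sum_sub_distrib, ← Finset.mul_sum, Finset.sum_add_distrib, hrow]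
  simp
  ring

/-- The Schwinger–Dyson identity for one entry `v = V p q`:
`(N + 1) E[v̄ g(v)] = (1 + δ_pq) E[∂g(v)] - E[∂̄g(v) (v̄_pp v̄_qq + v̄²)]`. The hypothesis `hg` says
that `G₁ = ∂g` and `G₂ = ∂̄g`. -/
lemma IsCOE.schwinger_dyson (hV : IsCOE V P)
    (hg : ∀ z, HasFDerivAt (𝕜 := ℝ) g
      (G₁ z • (ContinuousLinearMap.id ℝ ℂ) + G₂ z • (Complex.conjCLE : ℂ →L[ℝ] ℂ)) z)
    (h₁ : Continuous G₁) (h₂ : Continuous G₂) (p q : n) :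
    (Fintype.card n + 1) * ∫ ω, conj (V ω p q) * g (V ω p q) ∂P =
      (if p = q then 2 else 1) * ∫ ω, G₁ (V ω p q) ∂P -
        ∫ ω, G₂ (V ω p q) * (conj (V ω p p) * conj (V ω q q) + conj (V ω p q) ^ 2) ∂P := by
  have hgc : Continuous g := continuous_iff_continuousAt.2 fun z => (hg z).continuousAt
  have h0 : ∫ ω, ∑ a, wirtingerVariation g G₁ G₂ p a q (V ω) (Matrix.single a q 1) ∂P = 0 := by
    rw [integral_finsetSum _ fun a _ =>
      hV.integrable_comp (continuous_wirtingerVariation hgc h₁ h₂ p a q _)]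
    exact Finset.sum_eq_zero fun a _ => hV.integral_wirtingerVariation hg h₁ h₂ p a q _
  have hi1 := hV.integrable_comp (F := fun M => G₁ (M p q)) (by fun_prop)
  have hi2 := hV.integrable_comp
    (F := fun M => G₂ (M p q) * (conj (M p p) * conj (M q q) + conj (M p q) ^ 2)) (by fun_prop)
  have hi3 := hV.integrable_comp (F := fun M => conj (M p q) * g (M p q)) (by fun_prop)
  rw [integral_congr_ae (hV.unitary.mp (hV.symmetric.mono fun ω hs hu =>
    sum_wirtingerVariation_single hu hs p q)), integral_sub (by exact (hi1.const_mul _).sub hi2)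
      (hi3.const_mul _), integral_sub (hi1.const_mul _) hi2, integral_const_mul,
      integral_const_mul] at h0
  linear_combination -h0

end SchwingerDyson

/-! ### The characteristic function of an entry -/

section CharacteristicFunction

variable {Ω n : Type*} [MeasurableSpace Ω] [Fintype n] [DecidableEq n]
  {V : Ω → Matrix n n ℂ} {P : Measure Ω}

/-- The Schwinger–Dyson identity for `g z = z`. -/
lemma IsCOE.integral_normSq (hV : IsCOE V P) (p q : n) :
    ∫ ω, ‖V ω p q‖ ^ 2 ∂P = (if p = q then 2 else 1) / (Fintype.card n + 1) := by
  have := hV.isProbabilityMeasure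
  have h := hV.schwinger_dyson (g := fun z => z) (G₁ := fun _ => 1) (G₂ := fun _ => 0)
    (fun z => (hasFDerivAt_id (𝕜 := ℝ) z).congr_fderiv (by simp))
    continuous_const continuous_const p q
  have hn (ω : Ω) : conj (V ω p q) * V ω p q = ((‖V ω p q‖ ^ 2 : ℝ) : ℂ) := by
    rw [Complex.conj_mul']; simp
  simp_rw [hn] at h
  rw [integral_complex_ofReal] at h
  rw [eq_div_iff (by positivity), mul_comm]
  have h' : (((Fintype.card n + 1) * ∫ ω, ‖V ω p q‖ ^ 2 ∂P : ℝ) : ℂ) =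
      ((if p = q then 2 else 1 : ℝ) : ℂ) := by
    push_cast
    rw [h]
    split_ifs <;> simp
  exact_mod_cast h'

lemma IsCOE.integrable_normSq (hV : IsCOE V P) (p q : n) :
    Integrable (fun ω => ‖V ω p q‖ ^ 2) P := by
  have h := (hV.integrable_comp (F := fun M => ((‖M p q‖ ^ 2 : ℝ) : ℂ)) (by fun_prop)).re
  exact h.congr (Eventually.of_forall fun ω => Complex.ofReal_re _)

/-- The exponential `z ↦ exp (i Re (conj b * z))`, whose integral against a law on `ℂ` is the
characteristic function at `b`. The real part is written through `b` and `conj b` so that the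
Wirtinger derivatives can be read off. -/
noncomputable def expReInner (b z : ℂ) : ℂ :=
  Complex.exp ((conj b * z + b * conj z) / 2 * Complex.I)

lemma continuous_expReInner (b : ℂ) : Continuous (expReInner b) := by
  unfold expReInner
  fun_prop

lemma expReInner_eq (b z : ℂ) :
    expReInner b z = Complex.exp (((conj b * z).re : ℝ) * Complex.I) := by
  rw [expReInner, Complex.re_eq_add_conj]
  simp

lemma norm_expReInner (b z : ℂ) : ‖expReInner b z‖ = 1 := by
  rw [expReInner_eq, Complex.norm_exp_ofReal_mul_I]

lemma conj_expReInner (b z : ℂ) : conj (expReInner b z) = expReInner (-b) z := by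
  rw [expReInner, expReInner, ← Complex.exp_conj]
  congr 1
  simp only [map_mul, map_div₀, map_add, map_neg, map_ofNat, Complex.conj_I, Complex.conj_conj]
  ring

lemma hasFDerivAt_expReInner (b z : ℂ) :
    HasFDerivAt (𝕜 := ℝ) (expReInner b)
      ((conj b / 2 * Complex.I * expReInner b z) • (ContinuousLinearMap.id ℝ ℂ) +
        (b / 2 * Complex.I * expReInner b z) • (Complex.conjCLE : ℂ →L[ℝ] ℂ)) z := by
  have h1 : HasFDerivAt (𝕜 := ℝ) (fun z : ℂ => (conj b * z + b * conj z) / 2 * Complex.I)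
      ((conj b / 2 * Complex.I) • (ContinuousLinearMap.id ℝ ℂ) +
        (b / 2 * Complex.I) • (Complex.conjCLE : ℂ →L[ℝ] ℂ)) z := by
    have h := ((conj b / 2 * Complex.I) • (ContinuousLinearMap.id ℝ ℂ) +
        (b / 2 * Complex.I) • (Complex.conjCLE : ℂ →L[ℝ] ℂ)).hasFDerivAt (x := z)
    refine h.congr_of_eventuallyEq (Eventually.of_forall fun w => ?_)
    simp
    ring
  refine h1.cexp.congr_fderiv ?_
  ext w
  simp [expReInner]
  ring

lemma IsCOE.integral_conj_mul_expReInner (hV : IsCOE V P) (p q : n) (b : ℂ) :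
    (Fintype.card n + 1) * ∫ ω, conj (V ω p q) * expReInner b (V ω p q) ∂P =
      Complex.I / 2 * ((if p = q then 2 else 1) * conj b * ∫ ω, expReInner b (V ω p q) ∂P -
        b * ∫ ω, expReInner b (V ω p q) *
          (conj (V ω p p) * conj (V ω q q) + conj (V ω p q) ^ 2) ∂P) := by
  have hc := continuous_expReInner b
  rw [hV.schwinger_dyson (hasFDerivAt_expReInner b) (by fun_prop) (by fun_prop) p q]
  simp_rw [mul_assoc (_ * _) (expReInner _ _) (_ + _)]
  rw [integral_const_mul, integral_const_mul]
  ring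

/-- The complex conjugate of `IsCOE.integral_conj_mul_expReInner` at `-b`. -/
lemma IsCOE.integral_mul_expReInner (hV : IsCOE V P) (p q : n) (b : ℂ) :
    (Fintype.card n + 1) * ∫ ω, V ω p q * expReInner b (V ω p q) ∂P =
      Complex.I / 2 * ((if p = q then 2 else 1) * b * ∫ ω, expReInner b (V ω p q) ∂P -
        conj b * ∫ ω, expReInner b (V ω p q) * (V ω p p * V ω q q + V ω p q ^ 2) ∂P) := by
  have h := congrArg conj (hV.integral_conj_mul_expReInner p q (-b))
  simp only [map_mul, map_sub, map_add, map_neg, ← integral_conj, Complex.conj_conj,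
    conj_expReInner, neg_neg, map_pow, map_div₀, Complex.conj_I, map_natCast, map_one, map_ofNat,
    apply_ite conj] at h
  rw [h]
  ring

/-- The error term, at the frequency `c = s * b`, of the differential equation satisfied by the
characteristic function along the ray `s ↦ s * b`; it is quadratic in the entries. -/
noncomputable def charFunError (V : Ω → Matrix n n ℂ) (P : Measure Ω) (p q : n) (b c : ℂ) : ℂ :=
  ∫ ω, expReInner c (V ω p q) *
    (b ^ 2 * (conj (V ω p p) * conj (V ω q q) + conj (V ω p q) ^ 2) +
      conj b ^ 2 * (V ω p p * V ω q q + V ω p q ^ 2)) ∂P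

lemma IsCOE.norm_charFunError_le (hV : IsCOE V P) (p q : n) (b c : ℂ) :
    ‖charFunError V P p q b c‖ ≤ 8 * ‖b‖ ^ 2 / (Fintype.card n + 1) := by
  have hb : ∀ ω, ‖expReInner c (V ω p q) *
      (b ^ 2 * (conj (V ω p p) * conj (V ω q q) + conj (V ω p q) ^ 2) +
        conj b ^ 2 * (V ω p p * V ω q q + V ω p q ^ 2))‖ ≤
      ‖b‖ ^ 2 * (‖V ω p p‖ ^ 2 + ‖V ω q q‖ ^ 2 + 2 * ‖V ω p q‖ ^ 2) := by
    intro ω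
    have hR : ‖V ω p p * V ω q q + V ω p q ^ 2‖ ≤
        (‖V ω p p‖ ^ 2 + ‖V ω q q‖ ^ 2 + 2 * ‖V ω p q‖ ^ 2) / 2 := by
      refine (norm_add_le _ _).trans ?_
      rw [norm_mul, norm_pow]
      nlinarith [sq_nonneg (‖V ω p p‖ - ‖V ω q q‖)]
    have hR' : ‖conj (V ω p p) * conj (V ω q q) + conj (V ω p q) ^ 2‖ ≤
        (‖V ω p p‖ ^ 2 + ‖V ω q q‖ ^ 2 + 2 * ‖V ω p q‖ ^ 2) / 2 := by
      rw [← map_mul, ← map_pow, ← map_add, Complex.norm_conj]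
      exact hR
    rw [norm_mul, norm_expReInner, one_mul]
    refine (norm_add_le _ _).trans ?_
    rw [norm_mul, norm_mul, norm_pow, norm_pow, Complex.norm_conj]
    nlinarith [sq_nonneg ‖b‖, mul_le_mul_of_nonneg_left hR (sq_nonneg ‖b‖),
      mul_le_mul_of_nonneg_left hR' (sq_nonneg ‖b‖)]
  have hi1 := hV.integrable_normSq p p
  have hi2 := hV.integrable_normSq q q
  have hi3 := hV.integrable_normSq p q
  have hi12 : Integrable (fun ω => ‖V ω p p‖ ^ 2 + ‖V ω q q‖ ^ 2) P := hi1.add hi2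
  have hi : Integrable (fun ω => ‖b‖ ^ 2 *
      (‖V ω p p‖ ^ 2 + ‖V ω q q‖ ^ 2 + 2 * ‖V ω p q‖ ^ 2)) P :=
    (hi12.add (hi3.const_mul 2)).const_mul _
  refine (norm_integral_le_of_norm_le hi (Eventually.of_forall hb)).trans ?_
  rw [integral_const_mul, integral_add hi12 (hi3.const_mul 2), integral_add hi1 hi2,
    integral_const_mul, hV.integral_normSq, hV.integral_normSq, hV.integral_normSq]
  have hq : (if p = q then 2 else 1 : ℝ) ≤ 2 := by split_ifs <;> norm_num
  calc _ = ‖b‖ ^ 2 * (4 + 2 * (if p = q then 2 else 1)) / (Fintype.card n + 1 : ℝ) := by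
        simp only [if_true]; ring
    _ ≤ ‖b‖ ^ 2 * 8 / (Fintype.card n + 1 : ℝ) := by gcongr; linarith
    _ = _ := by ring

/-- Up to `charFunError`, the characteristic function of an entry solves the differential equation
of a Gaussian characteristic function along each ray. -/
lemma IsCOE.hasDerivAt_integral_expReInner (hV : IsCOE V P) (p q : n) (b : ℂ) (s : ℝ) :
    HasDerivAt (fun s : ℝ => ∫ ω, expReInner (s * b) (V ω p q) ∂P)
      (-(s / (4 * (Fintype.card n + 1))) *
        (2 * (if p = q then 2 else 1) * (‖b‖ ^ 2 : ℝ) * ∫ ω, expReInner (s * b) (V ω p q) ∂P -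
          charFunError V P p q b (s * b))) s := by
  have := hV.isProbabilityMeasure
  have hcs (c : ℂ) := continuous_expReInner c
  set d : ℝ → Matrix n n ℂ → ℂ := fun t M =>
    Complex.I / 2 * (conj b * (M p q * expReInner (t * b) (M p q)) +
      b * (conj (M p q) * expReInner (t * b) (M p q))) with hd
  have hdc (t : ℝ) : Continuous (d t) := by
    have := hcs (t * b)
    fun_prop
  have key := (hasDerivAt_integral_of_dominated_loc_of_deriv_le (μ := P) (x₀ := s)
    (s := Set.univ) (bound := fun _ => ‖b‖)
    (F := fun (t : ℝ) ω => expReInner (t * b) (V ω p q)) (F' := fun t ω => d t (V ω)) univ_mem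
    (Eventually.of_forall fun t => (hV.integrable_comp (F := fun M => expReInner (t * b) (M p q))
      (by have := hcs (t * b); fun_prop)).aestronglyMeasurable)
    (hV.integrable_comp (F := fun M => expReInner (s * b) (M p q))
      (by have := hcs (s * b); fun_prop))
    (hV.integrable_comp (hdc s)).aestronglyMeasurable
    (hV.unitary.mono fun ω hω t _ => ?_) (integrable_const _)
    (Eventually.of_forall fun ω t _ => ?_)).2
  · refine key.congr_deriv ?_
    have hi1 := hV.integrable_comp (F := fun M => M p q * expReInner (s * b) (M p q))
      (by have := hcs (s * b); fun_prop)
    have hi2 := hV.integrable_comp (F := fun M => conj (M p q) * expReInner (s * b) (M p q))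
      (by have := hcs (s * b); fun_prop)
    have hi3 := hV.integrable_comp (F := fun M => expReInner (s * b) (M p q) *
      (conj (M p p) * conj (M q q) + conj (M p q) ^ 2)) (by have := hcs (s * b); fun_prop)
    have hi4 := hV.integrable_comp (F := fun M => expReInner (s * b) (M p q) *
      (M p p * M q q + M p q ^ 2)) (by have := hcs (s * b); fun_prop)
    have e : charFunError V P p q b (s * b) =
        b ^ 2 * (∫ ω, expReInner (s * b) (V ω p q) *
          (conj (V ω p p) * conj (V ω q q) + conj (V ω p q) ^ 2) ∂P) +
        conj b ^ 2 * ∫ ω, expReInner (s * b) (V ω p q) *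
          (V ω p p * V ω q q + V ω p q ^ 2) ∂P := by
      rw [← integral_const_mul, ← integral_const_mul,
        ← integral_add (hi3.const_mul _) (hi4.const_mul _), charFunError]
      congr 1 with ω
      ring
    have hN : (Fintype.card n + 1 : ℂ) ≠ 0 := by exact_mod_cast Nat.succ_ne_zero (Fintype.card n)
    have h1 := hV.integral_mul_expReInner p q (s * b)
    have h2 := hV.integral_conj_mul_expReInner p q (s * b)
    rw [mul_comm, ← eq_div_iff hN] at h1 h2
    have hb : ((‖b‖ ^ 2 : ℝ) : ℂ) = conj b * b := by rw [Complex.conj_mul']; simp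
    rw [e, hb]
    simp only [hd]
    rw [integral_const_mul, integral_add (hi1.const_mul _) (hi2.const_mul _), integral_const_mul,
      integral_const_mul, h1, h2]
    simp only [map_mul, Complex.conj_ofReal]
    field_simp
    simp only [Complex.I_sq]
    ring
  · have h := entry_norm_bound_of_unitary hω p q
    simp only [hd, norm_mul, norm_div, Complex.norm_I, Complex.norm_ofNat]
    have h' : ‖conj b * (V ω p q * expReInner (t * b) (V ω p q)) +
        b * (conj (V ω p q) * expReInner (t * b) (V ω p q))‖ ≤ ‖b‖ + ‖b‖ := by
      refine (norm_add_le _ _).trans (add_le_add ?_ ?_) <;>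
      · simp only [norm_mul, norm_expReInner, Complex.norm_conj, mul_one]
        exact mul_le_of_le_one_right (norm_nonneg _) h
    linarith
  · have hs : HasDerivAt (fun r : ℝ => (conj (r * b) * V ω p q + r * b * conj (V ω p q)) / 2 *
        Complex.I) ((conj b * V ω p q + b * conj (V ω p q)) / 2 * Complex.I) t := by
      have h := (Complex.ofRealCLM.hasDerivAt (x := t)).mul_const
        ((conj b * V ω p q + b * conj (V ω p q)) / 2 * Complex.I)
      refine (h.congr_deriv (by simp)).congr_of_eventuallyEq (Eventually.of_forall fun r => ?_)
      simp
      ring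
    refine hs.cexp.congr_deriv ?_
    simp only [hd, expReInner]
    ring

/-- Quantitative comparison of the characteristic function of an entry with that of a centred
complex Gaussian of variance `(1 + δ_pq) / (N + 1)`, where `N = Fintype.card n`. -/
lemma IsCOE.norm_integral_expReInner_sub_le (hV : IsCOE V P) (p q : n) (b : ℂ) :
    ‖∫ ω, expReInner b (V ω p q) ∂P -
        Real.exp (-((if p = q then 2 else 1) * ‖b‖ ^ 2 / (4 * (Fintype.card n + 1))))‖ ≤
      2 * ‖b‖ ^ 2 / (Fintype.card n + 1) ^ 2 := by
  have := hV.isProbabilityMeasure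
  set N : ℝ := Fintype.card n + 1 with hN
  have hN0 : 0 < N := by positivity
  set κ : ℝ := (if p = q then 2 else 1) * ‖b‖ ^ 2 / (4 * N) with hκ
  have hκ0 : 0 ≤ κ := by
    have : (0 : ℝ) ≤ if p = q then 2 else 1 := by split_ifs <;> norm_num
    positivity
  set φ : ℝ → ℂ := fun s => ∫ ω, expReInner (s * b) (V ω p q) ∂P with hφ
  -- Multiplying by the integrating factor `exp (κ s²)` leaves only the error term.
  have hder (s : ℝ) : HasDerivAt (fun s : ℝ => (Real.exp (κ * s ^ 2) : ℂ) * φ s)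
      (Real.exp (κ * s ^ 2) * (s / (4 * N)) * charFunError V P p q b (s * b)) s := by
    have h1 : HasDerivAt (fun s : ℝ => (Real.exp (κ * s ^ 2) : ℂ))
        ((Real.exp (κ * s ^ 2) * (κ * (2 * s)) : ℝ) : ℂ) s := by
      refine HasDerivAt.ofReal_comp (HasDerivAt.exp ?_)
      simpa using (hasDerivAt_pow 2 s).const_mul κ
    refine (h1.mul (hV.hasDerivAt_integral_expReInner p q b s)).congr_deriv ?_
    have hκc : (κ : ℂ) = (if p = q then 2 else 1) * (‖b‖ ^ 2 : ℝ) / (4 * N) := by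
      rw [hκ]; split_ifs <;> push_cast <;> rfl
    have hNc : (Fintype.card n + 1 : ℂ) = N := by rw [hN]; push_cast; rfl
    have hN0c : (N : ℂ) ≠ 0 := by exact_mod_cast hN0.ne'
    rw [hNc]
    push_cast [hκc]
    field_simp
    ring
  have hb := norm_image_sub_le_of_norm_deriv_le_segment_01'
    (C := Real.exp κ * (2 * ‖b‖ ^ 2 / N ^ 2))
    (fun s _ => (hder s).hasDerivWithinAt) (fun s hs => ?_)
  · have h0 : φ 0 = 1 := by simp [hφ, expReInner]
    have h1 : φ 1 = ∫ ω, expReInner b (V ω p q) ∂P := by simp [hφ]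
    simp only [one_pow, mul_one, h0, h1] at hb
    have hfac : ∫ ω, expReInner b (V ω p q) ∂P - Real.exp (-κ) = Real.exp (-κ) *
        (Real.exp κ * ∫ ω, expReInner b (V ω p q) ∂P - 1) := by
      have : (Real.exp (-κ) : ℂ) * Real.exp κ = 1 := by
        rw [← Complex.ofReal_mul, ← Real.exp_add]; simp
      linear_combination (-(∫ ω, expReInner b (V ω p q) ∂P)) * this
    rw [hfac, norm_mul, Complex.norm_real, Real.norm_of_nonneg (Real.exp_pos _).le]
    calc _ ≤ Real.exp (-κ) * (Real.exp κ * (2 * ‖b‖ ^ 2 / N ^ 2)) := by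
          gcongr
          simpa using hb
      _ = _ := by rw [← mul_assoc, ← Real.exp_add]; simp
  · have he := hV.norm_charFunError_le p q b (s * b)
    have hs2 : s ^ 2 ≤ 1 := pow_le_one₀ hs.1 hs.2.le
    rw [norm_mul, norm_mul, Complex.norm_real, Real.norm_of_nonneg (Real.exp_pos _).le]
    have hsn : ‖(s : ℂ) / (4 * N)‖ ≤ 1 / (4 * N) := by
      rw [norm_div, norm_mul, Complex.norm_real, Complex.norm_real, Real.norm_of_nonneg hs.1,
        Real.norm_of_nonneg hN0.le, Complex.norm_ofNat]
      gcongr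
      exact hs.2.le
    calc _ ≤ Real.exp κ * (1 / (4 * N)) * (8 * ‖b‖ ^ 2 / N) := by
          gcongr
          exact mul_le_of_le_one_right hκ0 hs2
      _ = _ := by field_simp; ring

end CharacteristicFunction

/-! ### Convergence to the complex Gaussian -/

section GaussianLimit

lemma charFun_map_eq_integral_expReInner {Ω : Type*} [MeasurableSpace Ω] {P : Measure Ω}
    {X : Ω → ℂ} (hX : AEMeasurable X P) (w : ℂ) :
    charFun (P.map X) w = ∫ ω, expReInner w (X ω) ∂P := by
  rw [charFun_apply, integral_map hX (by fun_prop)]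
  congr 1 with ω
  rw [expReInner_eq, Complex.inner, ← Complex.conj_re]
  congr 3
  simp

lemma expReInner_mul_left (b z : ℂ) (r : ℝ) : expReInner b (r * z) = expReInner (r * b) z := by
  simp only [expReInner, map_mul, Complex.conj_ofReal]
  congr 1
  ring

lemma IsStandardComplexGaussian.aemeasurable {Ω : Type*} [MeasurableSpace Ω] {P : Measure Ω}
    {Z : Ω → ℂ} (hZ : IsStandardComplexGaussian Z P) : AEMeasurable Z P := by
  obtain ⟨X₁, X₂, h₁, h₂, -, hZ⟩ := hZ
  have h₁ := h₁.aemeasurable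
  have h₂ := h₂.aemeasurable
  rw [funext hZ]
  fun_prop

lemma IsStandardComplexGaussian.integral_expReInner {Ω : Type*} [MeasurableSpace Ω]
    {P : Measure Ω} {Z : Ω → ℂ} (hZ : IsStandardComplexGaussian Z P) (w : ℂ) :
    ∫ ω, expReInner w (Z ω) ∂P = Real.exp (-(‖w‖ ^ 2 / 4)) := by
  obtain ⟨X₁, X₂, h₁, h₂, hind, hZ⟩ := hZ
  have hc (X : Ω → ℝ) (hX : HasLaw X (gaussianReal 0 1) P) (x : ℝ) :
      ∫ ω, Complex.exp ((x / √2 : ℝ) * X ω * Complex.I) ∂P = Real.exp (-(x ^ 2 / 4)) := by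
    have h := charFun_gaussianReal (μ := 0) (v := 1) (x / √2)
    rw [← hX.map_eq, charFun_apply_real, integral_map hX.aemeasurable (by fun_prop)] at h
    rw [h, Complex.ofReal_exp]
    congr 1
    have h2 : ((√2 : ℝ) : ℂ) ^ 2 = 2 := by
      rw [← Complex.ofReal_pow, Real.sq_sqrt (by norm_num)]; simp
    push_cast
    rw [div_pow, h2]
    ring
  have hfac (ω : Ω) : expReInner w (Z ω) =
      Complex.exp ((w.re / √2 : ℝ) * X₁ ω * Complex.I) *
        Complex.exp ((w.im / √2 : ℝ) * X₂ ω * Complex.I) := by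
    rw [hZ, expReInner_eq, ← Complex.exp_add, ← add_mul]
    congr 2
    norm_cast
    rw [← mul_div_assoc, Complex.div_ofReal_re]
    simp
    ring
  have hmul := hind.integral_fun_comp_mul_comp
    (f := fun x : ℝ => Complex.exp ((w.re / √2 : ℝ) * x * Complex.I))
    (g := fun x : ℝ => Complex.exp ((w.im / √2 : ℝ) * x * Complex.I))
    h₁.aemeasurable h₂.aemeasurable (by fun_prop) (by fun_prop)
  rw [integral_congr_ae (Eventually.of_forall hfac), hmul, hc X₁ h₁, hc X₂ h₂,
    ← Complex.ofReal_mul, ← Real.exp_add, Complex.sq_norm, Complex.normSq_apply]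
  congr 2
  ring

lemma aemeasurable_matrixEntry {Ω : Type*} [MeasurableSpace Ω] {P : Measure Ω} {N : ℕ}
    {V : Ω → Matrix (Fin N) (Fin N) ℂ} (hV : AEMeasurable V P) (i j : ℕ) :
    AEMeasurable (fun ω => matrixEntry (V ω) i j) P := by
  unfold matrixEntry
  split_ifs
  · exact (Continuous.measurable (f := fun M : Matrix (Fin N) (Fin N) ℂ => M _ _)
      (by fun_prop)).comp_aemeasurable hV
  · exact aemeasurable_const

/-- Diagonal and off-diagonal entries are treated together: the label equality `i = j` enters only
through the variance factor `1 + δ_ij`. -/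
lemma tendstoInDistribution_matrixEntry {Ω : ℕ → Type*} [∀ N, MeasurableSpace (Ω N)]
    (P : ∀ N, Measure (Ω N)) [∀ N, IsProbabilityMeasure (P N)]
    (V : ∀ N, Ω N → Matrix (Fin N) (Fin N) ℂ)
    (hV : ∀ N, 1 ≤ N → IsCOE (V N) (P N))
    {Ω' : Type*} [MeasurableSpace Ω'] (P' : Measure Ω') [IsProbabilityMeasure P']
    (Z : Ω' → ℂ) (hZ : IsStandardComplexGaussian Z P')
    (i j : ℕ) (hi : 1 ≤ i) (hj : 1 ≤ j) :
    TendstoInDistribution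
      (fun (N : ℕ) (ω : Ω N) =>
        ((√((N : ℝ) / (if i = j then 2 else 1)) : ℝ) : ℂ) * matrixEntry (V N ω) i j)
      atTop Z P P' := by
  have hm (N : ℕ) : AEMeasurable (fun ω : Ω N =>
      ((√((N : ℝ) / (if i = j then 2 else 1)) : ℝ) : ℂ) * matrixEntry (V N ω) i j) (P N) := by
    rcases Nat.eq_zero_or_pos N with rfl | hN
    · simp
    · exact (aemeasurable_matrixEntry (hV N hN).aemeasurable i j).const_mul _
  refine ⟨hm, hZ.aemeasurable, ProbabilityMeasure.tendsto_iff_tendsto_charFun.2 fun w => ?_⟩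
  simp only [ProbabilityMeasure.coe_mk]
  simp_rw [charFun_map_eq_integral_expReInner hZ.aemeasurable,
    fun N => charFun_map_eq_integral_expReInner (hm N), hZ.integral_expReInner,
    expReInner_mul_left]
  -- `c = 1 + δ_ij`; the exponent at `b = √(N / c) w` is
  -- `c ‖b‖² / (4 (N + 1)) = ‖w‖² N / (4 (N + 1))`.
  set c : ℝ := if i = j then 2 else 1 with hc
  have hc1 : 1 ≤ c := by rw [hc]; split_ifs <;> norm_num
  have hlim : Tendsto (fun N : ℕ => (N : ℝ) / (N + 1)) atTop (𝓝 1) :=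
    tendsto_natCast_div_add_atTop 1
  have hexp : Tendsto (fun N : ℕ => (Real.exp (-(‖w‖ ^ 2 / 4 * (N / (N + 1)))) : ℂ)) atTop
      (𝓝 (Real.exp (-(‖w‖ ^ 2 / 4)) : ℂ)) := by
    have h := (hlim.const_mul (‖w‖ ^ 2 / 4)).neg.rexp
    rw [mul_one] at h
    exact (Complex.continuous_ofReal.tendsto _).comp h
  have herr : Tendsto (fun N : ℕ => 2 * ‖w‖ ^ 2 * (1 / ((N : ℝ) + 1))) atTop (𝓝 0) := by
    simpa only [mul_zero] using
      (tendsto_one_div_add_atTop_nhds_zero_nat (𝕜 := ℝ)).const_mul (2 * ‖w‖ ^ 2)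
  refine Tendsto.congr_dist hexp (squeeze_zero' (Eventually.of_forall fun _ => dist_nonneg) ?_ herr)
  -- For smaller `N` the entry does not exist and `matrixEntry` is `0`.
  filter_upwards [eventually_ge_atTop (max i j)] with N hN
  have hiN : i ≤ N := (le_max_left _ _).trans hN
  have hjN : j ≤ N := (le_max_right _ _).trans hN
  have hentry (M : Matrix (Fin N) (Fin N) ℂ) :
      matrixEntry M i j = M ⟨i - 1, by omega⟩ ⟨j - 1, by omega⟩ :=
    dif_pos ⟨⟨hi, hiN⟩, hj, hjN⟩
  have hNpos : (0 : ℝ) ≤ N / c := by positivity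
  have h := (hV N (hi.trans hiN)).norm_integral_expReInner_sub_le
    ⟨i - 1, by omega⟩ ⟨j - 1, by omega⟩ ((√((N : ℝ) / c) : ℝ) * w)
  have hij : ((⟨i - 1, by omega⟩ : Fin N) = ⟨j - 1, by omega⟩) ↔ i = j := by
    rw [Fin.mk.injEq]; omega
  have hnorm : ‖((√((N : ℝ) / c) : ℝ) : ℂ) * w‖ ^ 2 = N / c * ‖w‖ ^ 2 := by
    rw [norm_mul, Complex.norm_real, Real.norm_of_nonneg (Real.sqrt_nonneg _), mul_pow,
      Real.sq_sqrt hNpos]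
  simp only [hij, ← hc, hnorm, Fintype.card_fin] at h
  simp_rw [hentry]
  rw [dist_comm, dist_eq_norm]
  have hc0 : c ≠ 0 := by positivity
  have e : ‖w‖ ^ 2 / 4 * (N / ((N : ℝ) + 1)) = c * (N / c * ‖w‖ ^ 2) / (4 * (N + 1)) := by
    field_simp
  rw [e]
  refine h.trans ?_
  have h1 : (N : ℝ) / c ≤ N + 1 := (div_le_self (Nat.cast_nonneg _) hc1).trans (by linarith)
  calc 2 * ((N : ℝ) / c * ‖w‖ ^ 2) / ((N : ℝ) + 1) ^ 2
      ≤ 2 * (((N : ℝ) + 1) * ‖w‖ ^ 2) / ((N : ℝ) + 1) ^ 2 := by gcongr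
    _ = _ := by field_simp

end GaussianLimit

theorem corollary5p3 {Ω : ℕ → Type*} [∀ N, MeasurableSpace (Ω N)]
    (P : ∀ N, Measure (Ω N)) [∀ N, IsProbabilityMeasure (P N)]
    (V : ∀ N, Ω N → Matrix (Fin N) (Fin N) ℂ)
    (hV : ∀ N, 1 ≤ N → IsCOE (V N) (P N))
    {Ω' : Type*} [MeasurableSpace Ω'] (P' : Measure Ω') [IsProbabilityMeasure P']
    (Z : Ω' → ℂ) (hZ : IsStandardComplexGaussian Z P')
    (i j : ℕ) (hi : 1 ≤ i) (hj : 1 ≤ j) (hij : i ≠ j) :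
    TendstoInDistribution
        (fun (N : ℕ) (ω : Ω N) => ((√((N : ℝ) / 2) : ℝ) : ℂ) * matrixEntry (V N ω) i i)
        atTop Z P P' ∧
      TendstoInDistribution
        (fun (N : ℕ) (ω : Ω N) => ((√(N : ℝ) : ℝ) : ℂ) * matrixEntry (V N ω) i j)
        atTop Z P P' := by
  have hd := tendstoInDistribution_matrixEntry P V hV P' Z hZ i i hi hi
  have ho := tendstoInDistribution_matrixEntry P V hV P' Z hZ i j hi hj
  simp only [if_true] at hd
  simp only [if_neg hij, div_one] at ho
  exact ⟨hd, ho⟩
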